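/- Let $C_1,\dots,C_k$ be concept classes of measurable subsets of measurable spaces $X_1,\dots,X_k$, let $C=\boxtimes_i C_i=\{\prod_i c_i : c_i\in C_i\}$, a class over $X=\prod_i X_i$ with the product $\sigma$-algebra, and assume $\emptyset\in C$. Let $A_1,\dots,A_k$ be learning algorithms (sublearners): from an accuracy parameter, a confidence parameter and a labelled sample over $X_i$, $A_i$ computes a hypothesis in some number of steps. Fix $\varepsilon,\delta\in(0,1)$. For a target $c^*=\prod_i c_i^*\in C$ and a distribution $D$ on $X$, the example oracle $\mathrm{EX}$ draws independent points $\vec x\sim D$ labelled by whether $\vec x\in c^*$, a membership query asks whether a given point lies in $c^*$, and $\mathrm{err}(h)=D(h\,\triangle\,c^*)$. Consider the following learner for $C$. Draw a sample $S$ of $m$ labelled examples. If $S$ has no positive example, return $\emptyset$. Otherwise fix a positive example $\vec p$ in $S$ and, for each $i$, form a sample $S_i$ over $X_i$: each positive example $\vec x$ gives $(\vec x[i],\top)$, and each negative example $\vec x$ gives $\vec x[i]$ labelled with the answer to the membership query $\vec p[i\leftarrow \vec x[i]]\in c^*$. Run $A_i$ on $S_i$ with accuracy $\varepsilon/k$ and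 confidence $\delta/k$ to obtain $h_i$, and return $\prod_i h_i$. Then: 1. (Labelling) If $\vec p\in c^*$, then every example in $S_i$ is labelled correctly by $c_i^*$, for every $i$. 2. (Cost) For every $m$ the learner makes exactly $m$ queries to $\mathrm{EX}$ and at most $k\cdot m$ membership queries, and its running time is $O\big(\sum_i A_i(\varepsilon/k,\delta/k)\big)$ with an absolute constant (with unit cost for each query and elementary step, the constant $6$ suffices). Here $A_i(\varepsilon',\delta')$ is the worst-case time, over targets in $C_i$ and possible samples, for drawing $m$ labelled examples and running $A_i$ on them with parameters $\varepsilon',\delta'$. 3. (PAC learning with $m_C(\varepsilon,\delta)$ examples) Suppose that each $A_i$, with parameters $\varepsilon/k,\delta/k$, is an empirical risk minimizer for $C_i$: on samples labelled by a concept in $C_i$ it returns a concept in $C_i$ with the fewest misclassified examples. Let $m=m_C(\varepsilon,\delta)$ be a sample size for $C$, that is, a number of examples from which every empirical risk minimizer for $C$ PAC-learns $C$ with accuracy $\varepsilon$ and confidence $\delta$. Then the learner PAC-learns $C$ with accuracy $\varepsilon$ and confidence $\delta$: it always returns a concept in $C$, and for every $c^*\in C$ and every $D$, $\Pr[\mathrm{err}>\varepsilon]\le\delta$.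 4. (Arbitrary PAC sublearners) Suppose only that each $A_i$, with parameters $\varepsilon/k,\delta/k$, PAC-learns $C_i$ from $m$ examples with accuracy $\varepsilon/k$ and confidence $\delta/k$, returning concepts in $C_i$. Then for every $c^*\in C$ and every $D$, the learner always returns a concept in $C$, $\Pr[S\text{ contains a positive example and }\mathrm{err}>\varepsilon]\le\delta$, and $\Pr[\mathrm{err}>\varepsilon]\le\delta+(1-\varepsilon)^m$. -/

import Mathlib

open MeasureTheory

universe u v w

/-! ### Computations with an example oracle and a membership oracle -/

/-- A computation with access to the oracles of a target concept over `X`. It may return a value,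
perform `n` elementary steps, draw a labelled example, or ask a membership query. -/
inductive Comp (X : Type u) (α : Type v) : Type (max u v) where
  | ret (a : α) : Comp X α
  | step (n : ℕ) (p : Comp X α) : Comp X α
  | ex (f : X × Bool → Comp X α) : Comp X α
  | mem (x : X) (f : Bool → Comp X α) : Comp X α

/-- Sequential composition. -/
def Comp.bind {X : Type u} {α : Type v} {β : Type w} : Comp X α → (α → Comp X β) → Comp X β
  | .ret a, g => g a
  | .step n p, g => .step n (p.bind g)
  | .ex f, g => .ex fun z => (f z).bind g
  | .mem x f, g => .mem x fun b => (f b).bind g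

/-- The result of a run, with the number of oracle calls of each kind and the running time. -/
structure Outcome (α : Type v) where
  out : α
  exQueries : ℕ
  memQueries : ℕ
  time : ℕ

open Classical in
/-- Run a computation with target concept `c`, when the example oracle draws the points
`ω 0, ω 1, …` in this order. Every oracle call takes one unit of time. -/
noncomputable def Comp.run {X : Type u} {α : Type v} (c : Set X) :
    Comp X α → (ℕ → X) → Outcome α
  | .ret a, _ => ⟨a, 0, 0, 0⟩
  | .step n p, ω =>
      let r := p.run c ω
      ⟨r.out, r.exQueries, r.memQueries, r.time + n⟩
  | .ex f, ω =>
      let r := (f (ω 0, decide (ω 0 ∈ c))).run c fun j => ω (j + 1)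
      ⟨r.out, r.exQueries + 1, r.memQueries, r.time + 1⟩
  | .mem x f, ω =>
      let r := (f (decide (x ∈ c))).run c ω
      ⟨r.out, r.exQueries, r.memQueries + 1, r.time + 1⟩

/-- Draw `n` labelled examples. -/
def drawSample (X : Type u) : ℕ → Comp X (List (X × Bool))
  | 0 => .ret []
  | n + 1 => .ex fun z => (drawSample X n).bind fun S => .ret (z :: S)

/-- Run the computations `f 0, …, f (k - 1)` one after the other and collect the results. -/
def Comp.forFin {X : Type u} : {k : ℕ} → {β : Fin k → Type w} →
    (∀ i, Comp X (β i)) → Comp X (∀ i, β i)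
  | 0, _, _ => .ret fun i => i.elim0
  | _ + 1, _, f =>
      (f 0).bind fun a => (Comp.forFin fun i => f i.succ).bind fun g => .ret (Fin.cons a g)

/-! ### Learning -/

/-- A learning algorithm: from an accuracy parameter, a confidence parameter and a labelled sample
it computes a hypothesis in a certain number of elementary steps. -/
abbrev Learner (X : Type u) : Type u := ℝ → ℝ → List (X × Bool) → Set X × ℕ

/-- Draw `n` labelled examples and run the learner on them. -/
def Learner.onSample {X : Type u} (A : Learner X) (n : ℕ) (ε δ : ℝ) : Comp X (Set X) :=
  (drawSample X n).bind fun S => .step (A ε δ S).2 (.ret (A ε δ S).1)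

/-- The worst-case running time (the time for drawing the `n` examples included) over all targets
in the class `C` and all outcomes of the example oracle. -/
noncomputable def Learner.worstTime {X : Type u} (C : Set (Set X)) (A : Learner X)
    (n : ℕ) (ε δ : ℝ) : ℕ∞ :=
  ⨆ c ∈ C, ⨆ ω : ℕ → X, (((A.onSample n ε δ).run c ω).time : ℕ∞)

/-- The error of the hypothesis `h` for the target `c` under the distribution `D`. -/
noncomputable def err {X : Type u} [MeasurableSpace X] (D : Measure X) (c h : Set X) : ENNReal :=
  D (symmDiff h c)

/-- The law of the successive answers of an example oracle with distribution `D`: an independent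
sequence of points, each with law `D`. -/
noncomputable def iidSeq {X : Type u} [MeasurableSpace X] (D : Measure X) : Measure (ℕ → X) :=
  Measure.infinitePi fun _ => D

/-- `P` PAC-learns the class `C` with accuracy `ε` and confidence `δ`: it always returns a concept
in `C`, and for every distribution and every target in `C` the probability that the error of this
concept exceeds `ε` is at most `δ`. -/
def PACLearns {X : Type u} [MeasurableSpace X] (C : Set (Set X)) (P : Comp X (Set X))
    (ε δ : ℝ) : Prop :=
  ∀ c ∈ C, (∀ ω : ℕ → X, (P.run c ω).out ∈ C) ∧
    ∀ D : Measure X, IsProbabilityMeasure D →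
      iidSeq D {ω | ENNReal.ofReal ε < err D c (P.run c ω).out} ≤ ENNReal.ofReal δ

open Classical in
/-- The points of the list `l`, labelled by the concept `c`. -/
noncomputable def labelled {X : Type u} (c : Set X) (l : List X) : List (X × Bool) :=
  l.map fun x => (x, decide (x ∈ c))

open Classical in
/-- The number of examples in the sample `S` that `h` misclassifies. -/
noncomputable def misclassified {X : Type u} (h : Set X) (S : List (X × Bool)) : ℕ :=
  S.countP fun z => decide (z.1 ∈ h) != z.2

/-- `L` is an empirical risk minimizer for the class `C`: on every sample that is labelled by a
concept in `C`, it returns a concept in `C` with the least possible number of misclassified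
examples. -/
def IsERM {X : Type u} (C : Set (Set X)) (L : List (X × Bool) → Set X) : Prop :=
  ∀ c ∈ C, ∀ l : List X, L (labelled c l) ∈ C ∧
    ∀ h ∈ C, misclassified (L (labelled c l)) (labelled c l) ≤ misclassified h (labelled c l)

/-- `n` examples are enough to learn the class `C` with accuracy `ε` and confidence `δ`: every
empirical risk minimizer for `C` that is applied to `n` labelled examples PAC-learns `C`. -/
def SampleSizeSuffices {X : Type u} [MeasurableSpace X] (C : Set (Set X)) (ε δ : ℝ)
    (n : ℕ) : Prop :=
  ∀ L : List (X × Bool) → Set X, IsERM C L →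
    PACLearns C ((drawSample X n).bind fun S => .ret (L S)) ε δ

/-! ### The product of concept classes and its learner -/

/-- The class of all Cartesian products `∏ c i` with `c i ∈ C i`. -/
def boxProd {k : ℕ} {X : Fin k → Type u} (C : ∀ i, Set (Set (X i))) : Set (Set (∀ i, X i)) :=
  {s | ∃ c : ∀ i, Set (X i), (∀ i, c i ∈ C i) ∧ s = Set.univ.pi c}

/-- Split a sample of the product into a labelled sample of the component `i`, with a positive
example `p`. A positive example gives a positive example of the component; for a negative example
`x` the label is the answer to the membership query `p[i ← x i]`. Reading an example and preparing a
query take one step each. -/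
def splitSample {k : ℕ} {X : Fin k → Type u} (p : ∀ i, X i) (i : Fin k) :
    List ((∀ i, X i) × Bool) → Comp (∀ i, X i) (List (X i × Bool))
  | [] => .ret []
  | (x, true) :: S =>
      .step 1 ((splitSample p i S).bind fun T => .ret ((x i, true) :: T))
  | (x, false) :: S =>
      .step 2 (.mem (Function.update p i (x i)) fun b =>
        (splitSample p i S).bind fun T => .ret ((x i, b) :: T))

/-- With a positive example `p`, split the sample `S` for each component `i`, run the sublearner
`A i` on the result with parameters `ε / k` and `δ / k`, and return the product of the hypotheses
(each component costs one more step for storing its hypothesis). -/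
noncomputable def learnWithPositive {k : ℕ} {X : Fin k → Type u} (A : ∀ i, Learner (X i))
    (ε δ : ℝ) (p : ∀ i, X i) (S : List ((∀ i, X i) × Bool)) :
    Comp (∀ i, X i) (Set (∀ i, X i)) :=
  (Comp.forFin fun i =>
    (splitSample p i S).bind fun T =>
      .step ((A i (ε / k) (δ / k) T).2 + 1) (.ret (A i (ε / k) (δ / k) T).1)).bind
    fun h => .ret (Set.univ.pi h)

/-- The learner for the product: draw `m` labelled examples and look for a positive one (one step
for each example). If there is none, return `∅`; otherwise split the sample and run the
sublearners. -/
noncomputable def productLearner {k : ℕ} {X : Fin k → Type u} (A : ∀ i, Learner (X i))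
    (m : ℕ) (ε δ : ℝ) : Comp (∀ i, X i) (Set (∀ i, X i)) :=
  (drawSample (∀ i, X i) m).bind fun S => .step S.length <|
    match S.find? fun z => z.2 with
    | none => .ret ∅
    | some z => learnWithPositive A ε δ z.1 S

/-!
For a product target `∏ cᵢ` and a point `p` in it, `p[i ← y]` lies in the target exactly if `y ∈ cᵢ`.
One positive example and the membership oracle therefore simulate correctly labelled samples of all
components (`splitSample_run`), and the run of the learner is determined: it returns `∅` if there is
no positive example (`productLearner_run_of_forall_notMem`), and otherwise the product of what the
sublearners return on the projected sample, labelled by the `cᵢ`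
(`productLearner_run_of_exists_mem`). The bounds on queries and time are read off from this.

If the sublearners minimize the empirical risk, they are consistent with their samples, and so is
the product of their hypotheses. For each target there is thus an empirical risk minimizer for the
product class that agrees with the learner on the samples labelled by this target, and the sample
size of the product class applies to it (`productLearner_pacLearns_of_isERM`).

For arbitrary PAC sublearners, the projections of an i.i.d. sample from `D` to a component are an
i.i.d. sample from the marginal of `D`, and the error of a product is at most the sum of the errors
of its factors for the marginals (`err_univ_pi_le`). A union bound over the components gives the
failure probability `δ` on samples with a positive example. If there is none and the error of `∅`,
which is the mass of the target, exceeds `ε`, then `m` independent points have missed a set of mass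
more than `ε`, which has probability at most `(1 - ε) ^ m`.
-/

/-! ### Runs of composed computations -/

/-- After the first computation, the example oracle continues behind the points it has drawn. -/
theorem Comp.run_bind {X : Type u} {α : Type v} {β : Type w} (c : Set X) (p : Comp X α)
    (g : α → Comp X β) (ω : ℕ → X) :
    (p.bind g).run c ω =
      ⟨((g (p.run c ω).out).run c fun j => ω (j + (p.run c ω).exQueries)).out,
        (p.run c ω).exQueries +
          ((g (p.run c ω).out).run c fun j => ω (j + (p.run c ω).exQueries)).exQueries,
        (p.run c ω).memQueries +
          ((g (p.run c ω).out).run c fun j => ω (j + (p.run c ω).exQueries)).memQueries,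
        (p.run c ω).time +
          ((g (p.run c ω).out).run c fun j => ω (j + (p.run c ω).exQueries)).time⟩ := by
  induction p generalizing ω with
  | ret a => simp [Comp.bind, Comp.run]
  | step n p ih =>
    simp only [Comp.bind, Comp.run, ih, Outcome.mk.injEq, true_and]
    omega
  | ex f ih =>
    simp only [Comp.bind, Comp.run, ih, Outcome.mk.injEq]
    simp only [← add_assoc, true_and]
    omega
  | mem x f ih =>
    simp only [Comp.bind, Comp.run, ih, Outcome.mk.injEq, true_and]
    omega

theorem labelled_cons {X : Type u} (c : Set X) (x : X) (l : List X) [Decidable (x ∈ c)] :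
    labelled c (x :: l) = (x, decide (x ∈ c)) :: labelled c l := by
  simp only [labelled, List.map_cons, List.cons.injEq, Prod.mk.injEq, true_and, and_true]
  congr

@[simp]
theorem length_labelled {X : Type u} (c : Set X) (l : List X) :
    (labelled c l).length = l.length := by
  simp [labelled]

theorem drawSample_run {X : Type u} (c : Set X) (n : ℕ) (ω : ℕ → X) :
    (drawSample X n).run c ω = ⟨labelled c ((List.range n).map ω), n, 0, n⟩ := by
  classical
  induction n generalizing ω with
  | zero => simp [drawSample, Comp.run, labelled]
  | succ n ih =>
    simp only [drawSample, Comp.run, Comp.run_bind, ih, List.range_succ_eq_map, List.map_cons,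
      List.map_map, labelled_cons, Outcome.mk.injEq, add_zero, and_true]
    exact congrArg₂ _ (by congr) rfl

theorem Learner.onSample_run {X : Type u} (A : Learner X) (n : ℕ) (ε δ : ℝ) (c : Set X)
    (ω : ℕ → X) :
    (A.onSample n ε δ).run c ω =
      ⟨(A ε δ (labelled c ((List.range n).map ω))).1, n, 0,
        n + (A ε δ (labelled c ((List.range n).map ω))).2⟩ := by
  simp [Learner.onSample, Comp.run_bind, drawSample_run, Comp.run]

theorem Learner.le_worstTime {X : Type u} {C : Set (Set X)} (A : Learner X) (n : ℕ) (ε δ : ℝ)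
    {c : Set X} (hc : c ∈ C) (ω : ℕ → X) :
    ((n + (A ε δ (labelled c ((List.range n).map ω))).2 : ℕ) : ℕ∞) ≤ A.worstTime C n ε δ := by
  have h := le_iSup₂_of_le (f := fun c (_ : c ∈ C) =>
    ⨆ ω : ℕ → X, (((A.onSample n ε δ).run c ω).time : ℕ∞)) c hc
    (le_iSup (fun ω : ℕ → X => (((A.onSample n ε δ).run c ω).time : ℕ∞)) ω)
  rwa [A.onSample_run] at h

/-- Without draws from the example oracle, every component sees the same oracle answers `ω`. -/
theorem Comp.forFin_run {X : Type u} (c : Set X) (ω : ℕ → X) {k : ℕ} {β : Fin k → Type w}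
    (f : ∀ i, Comp X (β i)) (hf : ∀ i, ((f i).run c ω).exQueries = 0) :
    (Comp.forFin f).run c ω =
      ⟨fun i => ((f i).run c ω).out, 0, ∑ i, ((f i).run c ω).memQueries,
        ∑ i, ((f i).run c ω).time⟩ := by
  induction k with
  | zero =>
    simp only [Comp.forFin, Comp.run, Finset.univ_eq_empty, Finset.sum_empty, Outcome.mk.injEq,
      and_true]
    exact funext fun i => i.elim0
  | succ k ih =>
    have ih' := ih (fun i => f i.succ) fun i => hf i.succ
    simp only [Comp.forFin, Comp.run_bind, hf, add_zero, ih', Comp.run, Fin.sum_univ_succ,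
      Outcome.mk.injEq, and_true]
    exact Fin.cons_self_tail fun i => ((f i).run c ω).out

/-! ### Splitting a sample of the product -/

/-- Since the target is a product and `p` belongs to it, the query `p[i ← x i]` tests exactly
whether `x i` belongs to the component `c i`. -/
theorem splitSample_run {k : ℕ} {X : Fin k → Type u} (c : ∀ i, Set (X i)) {p : ∀ i, X i}
    (hp : p ∈ Set.univ.pi c) (i : Fin k) (l : List (∀ i, X i)) (ω : ℕ → ∀ i, X i) :
    ((splitSample p i (labelled (Set.univ.pi c) l)).run (Set.univ.pi c) ω).out =
        labelled (c i) (l.map fun x => x i) ∧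
      ((splitSample p i (labelled (Set.univ.pi c) l)).run (Set.univ.pi c) ω).exQueries = 0 ∧
      ((splitSample p i (labelled (Set.univ.pi c) l)).run (Set.univ.pi c) ω).memQueries ≤
        l.length ∧
      ((splitSample p i (labelled (Set.univ.pi c) l)).run (Set.univ.pi c) ω).time ≤
        3 * l.length := by
  classical
  induction l with
  | nil => simp [labelled, splitSample, Comp.run]
  | cons x l ih =>
    obtain ⟨h₁, h₂, h₃, h₄⟩ := ih
    by_cases hx : x ∈ Set.univ.pi c
    · have hxi : x i ∈ c i := hx i trivial
      simp only [labelled_cons, List.map_cons, hx, hxi, decide_true, splitSample, Comp.run,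
        Comp.run_bind, h₁, h₂, List.length_cons, true_and]
      omega
    · simp only [labelled_cons, List.map_cons, hx, decide_false, splitSample, Comp.run,
        Comp.run_bind, h₁, h₂, List.length_cons, true_and, add_zero,
        Set.update_mem_pi_iff_of_mem hp, Set.mem_univ, true_implies]
      omega

/-! ### The run of the product learner -/

/-- The hypothesis that the sublearner `A` computes from the points `l` labelled by `c`. -/
noncomputable def Learner.hypothesis {X : Type u} (A : Learner X) (ε δ : ℝ) (c : Set X)
    (l : List X) : Set X :=
  (A ε δ (labelled c l)).1

/-- The number of steps in which `A` computes its hypothesis from the points `l` labelled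
by `c`. -/
noncomputable def Learner.steps {X : Type u} (A : Learner X) (ε δ : ℝ) (c : Set X)
    (l : List X) : ℕ :=
  (A ε δ (labelled c l)).2

theorem learnWithPositive_run {k : ℕ} {X : Fin k → Type u} (A : ∀ i, Learner (X i)) (ε δ : ℝ)
    (c : ∀ i, Set (X i)) {p : ∀ i, X i} (hp : p ∈ Set.univ.pi c) (l : List (∀ i, X i))
    (ω : ℕ → ∀ i, X i) :
    let r := (learnWithPositive A ε δ p (labelled (Set.univ.pi c) l)).run (Set.univ.pi c) ω
    r.out = Set.univ.pi (fun i =>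
        (A i).hypothesis (ε / k) (δ / k) (c i) (l.map fun x => x i)) ∧
      r.exQueries = 0 ∧ r.memQueries ≤ k * l.length ∧
      r.time ≤ ∑ i, (3 * l.length +
        ((A i).steps (ε / k) (δ / k) (c i) (l.map fun x => x i) + 1)) := by
  have h := fun i => splitSample_run c hp i l ω
  intro r
  simp only [r, learnWithPositive]
  rw [Comp.run_bind, Comp.forFin_run]
  · simp only [Comp.run_bind, Comp.run, (h _).1, (h _).2.1, add_zero, true_and, zero_add]
    refine ⟨rfl, ?_, Finset.sum_le_sum fun i _ => add_le_add (h i).2.2.2 le_rfl⟩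
    calc _ ≤ ∑ _i : Fin k, l.length := Finset.sum_le_sum fun i _ => (h i).2.2.1
      _ = k * l.length := by simp
  · intro i
    simp [Comp.run_bind, Comp.run, (h i).2.1]

theorem find?_labelled_eq_none {X : Type u} {c : Set X} {l : List X} (hl : ∀ x ∈ l, x ∉ c) :
    (labelled c l).find? (fun z => z.2) = none := by
  simpa [labelled] using hl

theorem find?_labelled_eq_some {X : Type u} {c : Set X} {l : List X} (hl : ∃ x ∈ l, x ∈ c) :
    ∃ z, (labelled c l).find? (fun z => z.2) = some z ∧ z.1 ∈ c := by
  obtain ⟨x, hxl, hxc⟩ := hl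
  cases h : (labelled c l).find? fun z => z.2 with
  | none =>
    simp only [labelled, List.find?_eq_none, List.mem_map] at h
    exact (h _ ⟨x, hxl, rfl⟩ (by simpa using hxc)).elim
  | some z =>
    refine ⟨z, rfl, ?_⟩
    have h₁ := List.find?_some h
    obtain ⟨y, -, rfl⟩ := List.mem_map.1 (List.mem_of_find?_eq_some h)
    simpa using h₁

theorem productLearner_run_of_forall_notMem {k : ℕ} {X : Fin k → Type u}
    (A : ∀ i, Learner (X i)) (m : ℕ) (ε δ : ℝ) (c : Set (∀ i, X i)) (ω : ℕ → ∀ i, X i)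
    (h : ∀ j < m, ω j ∉ c) :
    (productLearner A m ε δ).run c ω = ⟨∅, m, 0, m + m⟩ := by
  have hf : (labelled c ((List.range m).map ω)).find? (fun z => z.2) = none :=
    find?_labelled_eq_none (by simpa using h)
  simp [productLearner, Comp.run_bind, drawSample_run, Comp.run, hf]

theorem productLearner_run_of_exists_mem {k : ℕ} {X : Fin k → Type u}
    (A : ∀ i, Learner (X i)) (m : ℕ) (ε δ : ℝ) (c : ∀ i, Set (X i)) (ω : ℕ → ∀ i, X i)
    (h : ∃ j < m, ω j ∈ Set.univ.pi c) :
    let r := (productLearner A m ε δ).run (Set.univ.pi c) ω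
    r.out = Set.univ.pi (fun i =>
        (A i).hypothesis (ε / k) (δ / k) (c i) ((List.range m).map fun j => ω j i)) ∧
      r.exQueries = m ∧ r.memQueries ≤ k * m ∧
      r.time ≤ m + m + ∑ i, (3 * m +
        ((A i).steps (ε / k) (δ / k) (c i) ((List.range m).map fun j => ω j i) + 1)) := by
  obtain ⟨z, hz, hzc⟩ := find?_labelled_eq_some (c := Set.univ.pi c)
    (l := (List.range m).map ω) (by simpa using h)
  have hl := learnWithPositive_run A ε δ c hzc ((List.range m).map ω) fun j => ω (j + m)
  simp only [List.length_map, List.length_range, List.map_map] at hl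
  obtain ⟨h₁, h₂, h₃, h₄⟩ := hl
  intro r
  simp only [r, productLearner, Comp.run_bind, drawSample_run, Comp.run, hz, h₁, h₂, add_zero,
    zero_add, length_labelled, List.length_map, List.length_range]
  refine ⟨by rfl, trivial, h₃, ?_⟩
  simp only [Function.comp_def] at h₄
  omega

/-- A product over no components is never empty. -/
theorem pos_of_empty_mem_boxProd {k : ℕ} {X : Fin k → Type u} {C : ∀ i, Set (Set (X i))}
    (h : ∅ ∈ boxProd C) : 0 < k := by
  obtain ⟨c, -, hc⟩ := h
  rcases k.eq_zero_or_pos with rfl | hk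
  · have : (fun i : Fin 0 => i.elim0) ∈ (∅ : Set (∀ i, X i)) := hc ▸ fun i => i.elim0
    exact this.elim
  · exact hk

/-- Each component costs at most `3 * m + 1` steps besides the run of the sublearner, and the
examples are drawn and searched in `2 * m` steps. If there is a positive
example, then `m ≥ 1`, and as the worst-case time of a sublearner contains the `m` steps for drawing
its examples, the constant `6` covers the total `2 * m + 3 * k * m + k` of this overhead. -/
theorem productLearner_cost {k : ℕ} {X : Fin k → Type u} (C : ∀ i, Set (Set (X i)))
    (hk : 0 < k) (A : ∀ i, Learner (X i)) (m : ℕ) (ε δ : ℝ) {c : Set (∀ i, X i)}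
    (hc : c ∈ boxProd C) (ω : ℕ → ∀ i, X i) :
    ((productLearner A m ε δ).run c ω).exQueries = m ∧
      ((productLearner A m ε δ).run c ω).memQueries ≤ k * m ∧
      (((productLearner A m ε δ).run c ω).time : ℕ∞) ≤
        6 * ∑ i, (A i).worstTime (C i) m (ε / k) (δ / k) := by
  obtain ⟨c, hcC, rfl⟩ := hc
  let t : Fin k → ℕ := fun i =>
    (A i).steps (ε / k) (δ / k) (c i) ((List.range m).map fun j => ω j i)
  have hw : ((6 * ∑ i, (m + t i) : ℕ) : ℕ∞) ≤
      6 * ∑ i, (A i).worstTime (C i) m (ε / k) (δ / k) := by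
    push_cast
    gcongr with i
    exact_mod_cast (A i).le_worstTime m (ε / k) (δ / k) (hcC i) fun j => ω j i
  have hkm : m ≤ k * m := Nat.le_mul_of_pos_left m hk
  have hsum : ∑ i, (m + t i) = k * m + ∑ i, t i := by simp [Finset.sum_add_distrib]
  by_cases h : ∃ j < m, ω j ∈ Set.univ.pi c
  · obtain ⟨-, h₂, h₃, h₄⟩ := productLearner_run_of_exists_mem A m ε δ c ω h
    refine ⟨h₂, h₃, le_trans (Nat.cast_le.2 (h₄.trans ?_)) hw⟩
    obtain ⟨j, hj, -⟩ := h
    have hkm' : k ≤ k * m := Nat.le_mul_of_pos_right k (by omega)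
    have hsum' : ∑ i, (3 * m + (t i + 1)) = 3 * (k * m) + (∑ i, t i + k) := by
      simp [Finset.sum_add_distrib]
      ring
    change m + m + ∑ i, (3 * m + (t i + 1)) ≤ _
    omega
  · push Not at h
    rw [productLearner_run_of_forall_notMem A m ε δ _ ω h]
    exact ⟨rfl, Nat.zero_le _, le_trans (Nat.cast_le.2 (by dsimp only; omega)) hw⟩

theorem productLearner_out_mem {k : ℕ} {X : Fin k → Type u} {C : ∀ i, Set (Set (X i))}
    (hempty : ∅ ∈ boxProd C) (A : ∀ i, Learner (X i)) (m : ℕ) (ε δ : ℝ) (c : ∀ i, Set (X i))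
    (ω : ℕ → ∀ i, X i)
    (hA : ∀ i, (A i).hypothesis (ε / k) (δ / k) (c i) ((List.range m).map fun j => ω j i) ∈ C i) :
    ((productLearner A m ε δ).run (Set.univ.pi c) ω).out ∈ boxProd C := by
  by_cases h : ∃ j < m, ω j ∈ Set.univ.pi c
  · rw [(productLearner_run_of_exists_mem A m ε δ c ω h).1]
    exact ⟨_, hA, rfl⟩
  · push Not at h
    rwa [productLearner_run_of_forall_notMem A m ε δ _ ω h]

/-! ### Empirical risk minimizers -/

theorem misclassified_labelled_eq_zero_iff {X : Type u} (h c : Set X) (l : List X) :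
    misclassified h (labelled c l) = 0 ↔ ∀ x ∈ l, (x ∈ h ↔ x ∈ c) := by
  classical
  simp [misclassified, labelled, List.countP_eq_zero]

theorem IsERM.hypothesis_mem_iff {X : Type u} {C : Set (Set X)} {A : Learner X} {ε δ : ℝ}
    (hA : IsERM C fun S => (A ε δ S).1) {c : Set X} (hc : c ∈ C) {l : List X} {x : X}
    (hx : x ∈ l) : x ∈ A.hypothesis ε δ c l ↔ x ∈ c := by
  have h := (hA c hc l).2 c hc
  rw [(misclassified_labelled_eq_zero_iff c c l).2 fun _ _ => Iff.rfl, Nat.le_zero,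
    misclassified_labelled_eq_zero_iff] at h
  exact h x hx

theorem productLearner_out_consistent {k : ℕ} {X : Fin k → Type u} {C : ∀ i, Set (Set (X i))}
    {A : ∀ i, Learner (X i)} {ε δ : ℝ}
    (hA : ∀ i, IsERM (C i) fun S => (A i (ε / k) (δ / k) S).1) (m : ℕ) {c : ∀ i, Set (X i)}
    (hc : ∀ i, c i ∈ C i) (ω : ℕ → ∀ i, X i) :
    ∀ j < m, (ω j ∈ ((productLearner A m ε δ).run (Set.univ.pi c) ω).out ↔
      ω j ∈ Set.univ.pi c) := by
  intro j hj
  by_cases h : ∃ j < m, ω j ∈ Set.univ.pi c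
  · rw [(productLearner_run_of_exists_mem A m ε δ c ω h).1, Set.mem_univ_pi, Set.mem_univ_pi]
    exact forall_congr' fun i => (hA i).hypothesis_mem_iff (hc i)
      (List.mem_map.2 ⟨j, List.mem_range.2 hj, rfl⟩)
  · push Not at h
    rw [productLearner_run_of_forall_notMem A m ε δ _ ω h]
    simpa using h j hj

/-- The output depends on the example oracle only through the first `m` points. -/
theorem productLearner_out_congr {k : ℕ} {X : Fin k → Type u} (A : ∀ i, Learner (X i)) (m : ℕ)
    (ε δ : ℝ) (c : ∀ i, Set (X i)) {ω ω' : ℕ → ∀ i, X i} (h : ∀ j < m, ω j = ω' j) :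
    ((productLearner A m ε δ).run (Set.univ.pi c) ω).out =
      ((productLearner A m ε δ).run (Set.univ.pi c) ω').out := by
  by_cases hp : ∃ j < m, ω j ∈ Set.univ.pi c
  · have hp' : ∃ j < m, ω' j ∈ Set.univ.pi c := by
      obtain ⟨j, hj, hjc⟩ := hp
      exact ⟨j, hj, h j hj ▸ hjc⟩
    rw [(productLearner_run_of_exists_mem A m ε δ c ω hp).1,
      (productLearner_run_of_exists_mem A m ε δ c ω' hp').1]
    have hl : ∀ i, ((List.range m).map fun j => ω j i) = (List.range m).map fun j => ω' j i :=
      fun i => List.map_congr_left fun j hj => by rw [h j (List.mem_range.1 hj)]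
    simp only [hl]
  · push Not at hp
    rw [productLearner_run_of_forall_notMem A m ε δ _ ω hp,
      productLearner_run_of_forall_notMem A m ε δ _ ω' fun j hj => h j hj ▸ hp j hj]

/-- The membership queries make the output depend on more than the sample, so the learner itself is
not an empirical risk minimizer in the sense of `IsERM`. For a fixed target, however, its output
agrees with that of such a minimizer on every sample labelled by this target. -/
theorem productLearner_pacLearns_of_isERM {k : ℕ} {X : Fin k → Type u}
    [∀ i, MeasurableSpace (X i)] {C : ∀ i, Set (Set (X i))} (hempty : ∅ ∈ boxProd C)
    {A : ∀ i, Learner (X i)} {ε δ : ℝ}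
    (hA : ∀ i, IsERM (C i) fun S => (A i (ε / k) (δ / k) S).1) {m : ℕ}
    (hm : SampleSizeSuffices (boxProd C) ε δ m) :
    PACLearns (boxProd C) (productLearner A m ε δ) ε δ := by
  classical
  rintro c ⟨c, hc, rfl⟩
  have hout : ∀ ω, ((productLearner A m ε δ).run (Set.univ.pi c) ω).out ∈ boxProd C := fun ω =>
    productLearner_out_mem hempty A m ε δ c ω fun i => (hA i (c i) (hc i) _).1
  -- Every sample labelled by a concept in the class has a consistent concept. On samples of size
  -- `m` labelled by the target, the output of the product learner can be taken.
  have key : ∀ S : List ((∀ i, X i) × Bool), ∃ h : Set (∀ i, X i),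
      (∀ s ∈ boxProd C, ∀ l, S = labelled s l → h ∈ boxProd C ∧ misclassified h S = 0) ∧
      ∀ ω : ℕ → ∀ i, X i, S = labelled (Set.univ.pi c) ((List.range m).map ω) →
        h = ((productLearner A m ε δ).run (Set.univ.pi c) ω).out := by
    intro S
    by_cases hS : ∃ ω : ℕ → ∀ i, X i, S = labelled (Set.univ.pi c) ((List.range m).map ω)
    · obtain ⟨ω, rfl⟩ := hS
      refine ⟨_, fun s _ l _ => ⟨hout ω, ?_⟩, fun ω' hω' =>
        productLearner_out_congr A m ε δ c fun j hj => ?_⟩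
      · rw [misclassified_labelled_eq_zero_iff]
        simpa using productLearner_out_consistent hA m hc ω
      · have h := congrArg (List.map Prod.fst) hω'
        simp only [labelled, List.map_map] at h
        exact List.map_inj_left.1 h j (List.mem_range.2 hj)
    · by_cases hS' : ∃ s ∈ boxProd C, ∃ l, S = labelled s l
      · obtain ⟨s, hs, l, rfl⟩ := hS'
        exact ⟨s, fun _ _ _ _ =>
          ⟨hs, (misclassified_labelled_eq_zero_iff s s l).2 fun _ _ => Iff.rfl⟩,
          fun ω hω => (hS ⟨ω, hω⟩).elim⟩
      · exact ⟨∅, fun s hs l hl => (hS' ⟨s, hs, l, hl⟩).elim, fun ω hω => (hS ⟨ω, hω⟩).elim⟩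
  choose L hL hLω using key
  have hERM : IsERM (boxProd C) L := fun s hs l =>
    ⟨(hL _ s hs l rfl).1, fun h _ => by rw [(hL _ s hs l rfl).2]; exact Nat.zero_le _⟩
  refine ⟨hout, fun D hD => ?_⟩
  have hrun : ∀ ω, (((drawSample (∀ i, X i) m).bind fun S => .ret (L S)).run
      (Set.univ.pi c) ω).out = ((productLearner A m ε δ).run (Set.univ.pi c) ω).out := fun ω => by
    rw [Comp.run_bind, drawSample_run]
    exact hLω _ ω rfl
  simpa only [hrun] using (hm L hERM _ ⟨c, hc, rfl⟩).2 D hD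

/-! ### Arbitrary PAC sublearners -/

/-- The inequality holds for every set `B`, measurable or not, since the measure of a preimage is
at most the outer measure of the set under the image measure. -/
theorem iidSeq_preimage_le {X Y : Type*} [MeasurableSpace X] [MeasurableSpace Y] (D : Measure X)
    [IsProbabilityMeasure D] {f : X → Y} (hf : Measurable f) (B : Set (ℕ → Y)) :
    iidSeq D {ω | (fun j => f (ω j)) ∈ B} ≤ iidSeq (D.map f) B := by
  have hφ : Measurable fun (ω : ℕ → X) j => f (ω j) := by fun_prop
  have hmap : iidSeq (D.map f) = (iidSeq D).map fun ω j => f (ω j) := by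
    exact (Measure.infinitePi_map_pi (μ := fun _ : ℕ => D) fun _ => hf).symm
  rw [hmap]
  exact Measure.le_map_apply hφ.aemeasurable B

theorem iidSeq_forall_lt_mem {X : Type*} [MeasurableSpace X] (D : Measure X)
    [IsProbabilityMeasure D] {s : Set X} (hs : MeasurableSet s) (m : ℕ) :
    iidSeq D {ω | ∀ j < m, ω j ∈ s} = D s ^ m := by
  have h : {ω : ℕ → X | ∀ j < m, ω j ∈ s} = Set.pi (Finset.range m) fun _ => s := by
    ext ω
    simp [Set.mem_pi]
  rw [h, iidSeq, Measure.infinitePi_pi _ fun _ _ => hs]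
  simp

theorem err_univ_pi_le {k : ℕ} {X : Fin k → Type u} [∀ i, MeasurableSpace (X i)]
    (D : Measure (∀ i, X i)) {c h : ∀ i, Set (X i)} (hc : ∀ i, MeasurableSet (c i))
    (hh : ∀ i, MeasurableSet (h i)) :
    err D (Set.univ.pi c) (Set.univ.pi h) ≤ ∑ i, err (D.map fun x => x i) (c i) (h i) := by
  have hsub : symmDiff (Set.univ.pi h) (Set.univ.pi c) ⊆
      ⋃ i, (fun x : ∀ i, X i => x i) ⁻¹' symmDiff (h i) (c i) := by
    intro x hx
    by_contra hn
    simp only [Set.mem_iUnion, Set.mem_preimage, Set.mem_symmDiff, not_exists] at hn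
    have hiff : ∀ i, x i ∈ h i ↔ x i ∈ c i := fun i => by
      have := hn i
      tauto
    simp only [Set.mem_symmDiff, Set.mem_univ_pi, hiff] at hx
    tauto
  calc err D (Set.univ.pi c) (Set.univ.pi h)
      ≤ D (⋃ i, (fun x : ∀ i, X i => x i) ⁻¹' symmDiff (h i) (c i)) := measure_mono hsub
    _ ≤ ∑ i, D ((fun x : ∀ i, X i => x i) ⁻¹' symmDiff (h i) (c i)) := measure_iUnion_fintype_le _ _
    _ = ∑ i, err (D.map fun x => x i) (c i) (h i) :=
        Finset.sum_congr rfl fun i _ =>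
          (Measure.map_apply (measurable_pi_apply i) ((hh i).symmDiff (hc i))).symm

theorem sum_ofReal_div_card {k : ℕ} (hk : 0 < k) {a : ℝ} (ha : 0 ≤ a) :
    ∑ _i : Fin k, ENNReal.ofReal (a / k) = ENNReal.ofReal a := by
  rw [← ENNReal.ofReal_sum_of_nonneg fun _ _ => by positivity]
  congr 1
  simp
  field_simp

/-- The sublearners are run on the projections of the sample, which are i.i.d. samples from the
marginals of `D`; the claim is a union bound over the components. -/
theorem productLearner_pac_of_positive {k : ℕ} {X : Fin k → Type u}
    [∀ i, MeasurableSpace (X i)] {C : ∀ i, Set (Set (X i))}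
    (hC : ∀ i, ∀ c ∈ C i, MeasurableSet c) (hk : 0 < k) {A : ∀ i, Learner (X i)} {ε δ : ℝ}
    (hε : 0 ≤ ε) (hδ : 0 ≤ δ) {m : ℕ}
    (hA : ∀ i, PACLearns (C i) ((A i).onSample m (ε / k) (δ / k)) (ε / k) (δ / k))
    {c : ∀ i, Set (X i)} (hc : ∀ i, c i ∈ C i) (D : Measure (∀ i, X i))
    [IsProbabilityMeasure D] :
    iidSeq D {ω | (∃ j < m, ω j ∈ Set.univ.pi c) ∧ ENNReal.ofReal ε <
      err D (Set.univ.pi c) ((productLearner A m ε δ).run (Set.univ.pi c) ω).out} ≤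
        ENNReal.ofReal δ := by
  let B : ∀ i, Set (ℕ → X i) := fun i => {ω | ENNReal.ofReal (ε / k) <
    err (D.map fun x => x i) (c i) (((A i).onSample m (ε / k) (δ / k)).run (c i) ω).out}
  have hsub : {ω | (∃ j < m, ω j ∈ Set.univ.pi c) ∧ ENNReal.ofReal ε <
      err D (Set.univ.pi c) ((productLearner A m ε δ).run (Set.univ.pi c) ω).out} ⊆
        ⋃ i, {ω : ℕ → ∀ i, X i | (fun j => ω j i) ∈ B i} := by
    rintro ω ⟨hpos, hω⟩
    by_contra hn
    simp only [B, Set.mem_iUnion, Set.mem_ofPred_eq, not_exists, not_lt] at hn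
    refine hω.not_ge ?_
    rw [(productLearner_run_of_exists_mem A m ε δ c ω hpos).1, ← sum_ofReal_div_card hk hε]
    have hmeas : ∀ i, MeasurableSet ((A i).hypothesis (ε / k) (δ / k) (c i)
        ((List.range m).map fun j => ω j i)) := fun i => hC i _ (by
      have h := (hA i (c i) (hc i)).1 fun j => ω j i
      rwa [Learner.onSample_run] at h)
    refine (err_univ_pi_le D (fun i => hC i _ (hc i)) hmeas).trans
      (Finset.sum_le_sum fun i _ => ?_)
    have h := hn i
    rwa [Learner.onSample_run] at h
  calc _ ≤ iidSeq D (⋃ i, {ω : ℕ → ∀ i, X i | (fun j => ω j i) ∈ B i}) := measure_mono hsub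
    _ ≤ ∑ i, iidSeq D {ω : ℕ → ∀ i, X i | (fun j => ω j i) ∈ B i} :=
        measure_iUnion_fintype_le _ _
    _ ≤ ∑ _i : Fin k, ENNReal.ofReal (δ / k) := Finset.sum_le_sum fun i _ =>
        (iidSeq_preimage_le D (measurable_pi_apply i) (B i)).trans
          ((hA i (c i) (hc i)).2 _
            (Measure.isProbabilityMeasure_map (measurable_pi_apply i).aemeasurable))
    _ = ENNReal.ofReal δ := sum_ofReal_div_card hk hδ

/-- Without a positive example the learner returns `∅`, whose error `D c` exceeds `ε` only if each
of the `m` examples is negative with probability less than `1 - ε`. -/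
theorem productLearner_pac_of_negative {k : ℕ} {X : Fin k → Type u}
    [∀ i, MeasurableSpace (X i)] (A : ∀ i, Learner (X i)) {ε δ : ℝ} (hε : 0 ≤ ε) (m : ℕ)
    {c : Set (∀ i, X i)} (hc : MeasurableSet c) (D : Measure (∀ i, X i))
    [IsProbabilityMeasure D] :
    iidSeq D {ω | (∀ j < m, ω j ∉ c) ∧ ENNReal.ofReal ε <
      err D c ((productLearner A m ε δ).run c ω).out} ≤ ENNReal.ofReal ((1 - ε) ^ m) := by
  have herr : ∀ ω : ℕ → ∀ i, X i, (∀ j < m, ω j ∉ c) →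
      err D c ((productLearner A m ε δ).run c ω).out = D c := fun ω h => by
    rw [productLearner_run_of_forall_notMem A m ε δ c ω h, err]
    simp [symmDiff]
  by_cases hD : ENNReal.ofReal ε < D c
  · have hε1 : ε ≤ 1 := by
      rw [← ENNReal.ofReal_le_one]
      exact hD.le.trans prob_le_one
    calc _ ≤ iidSeq D {ω | ∀ j < m, ω j ∈ cᶜ} := measure_mono fun ω h => h.1
      _ = (1 - D c) ^ m := by rw [iidSeq_forall_lt_mem D hc.compl, prob_compl_eq_one_sub hc]
      _ ≤ (1 - ENNReal.ofReal ε) ^ m := by gcongr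
      _ = ENNReal.ofReal ((1 - ε) ^ m) := by
        rw [ENNReal.ofReal_pow (by linarith), ENNReal.ofReal_sub _ hε, ENNReal.ofReal_one]
  · have : {ω | (∀ j < m, ω j ∉ c) ∧ ENNReal.ofReal ε <
        err D c ((productLearner A m ε δ).run c ω).out} = ∅ :=
      Set.eq_empty_of_forall_notMem fun ω h => hD (herr ω h.1 ▸ h.2)
    rw [this, measure_empty]
    exact zero_le

theorem mainTheorem11 {k : ℕ} {X : Fin k → Type u} [∀ i, MeasurableSpace (X i)]
    (C : ∀ i, Set (Set (X i))) (hC : ∀ i, ∀ c ∈ C i, MeasurableSet c)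
    (hempty : ∅ ∈ boxProd C) (A : ∀ i, Learner (X i))
    (ε δ : ℝ) (hε : ε ∈ Set.Ioo (0 : ℝ) 1) (hδ : δ ∈ Set.Ioo (0 : ℝ) 1) :
    -- the component samples are labelled correctly
    (∀ c : ∀ i, Set (X i), ∀ p ∈ Set.univ.pi c, ∀ (i : Fin k) (l : List (∀ i, X i))
        (ω : ℕ → ∀ i, X i),
      ((splitSample p i (labelled (Set.univ.pi c) l)).run (Set.univ.pi c) ω).out =
        labelled (c i) (l.map fun x => x i)) ∧
    -- the numbers of queries and the running time
    (∀ m : ℕ, ∀ c ∈ boxProd C, ∀ ω : ℕ → ∀ i, X i,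
      ((productLearner A m ε δ).run c ω).exQueries = m ∧
      ((productLearner A m ε δ).run c ω).memQueries ≤ k * m ∧
      (((productLearner A m ε δ).run c ω).time : ℕ∞) ≤
        6 * ∑ i, (A i).worstTime (C i) m (ε / k) (δ / k)) ∧
    -- sublearners that minimize the empirical risk, and `m` the sample complexity of the product
    ((∀ i, IsERM (C i) fun S => (A i (ε / k) (δ / k) S).1) →
      ∀ m : ℕ, SampleSizeSuffices (boxProd C) ε δ m →
        PACLearns (boxProd C) (productLearner A m ε δ) ε δ) ∧
    -- arbitrary sublearners that PAC-learn their classes from `m` examples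
    (∀ m : ℕ,
      (∀ i, PACLearns (C i) ((A i).onSample m (ε / k) (δ / k)) (ε / k) (δ / k)) →
      ∀ c ∈ boxProd C,
        (∀ ω, ((productLearner A m ε δ).run c ω).out ∈ boxProd C) ∧
        ∀ D : Measure (∀ i, X i), IsProbabilityMeasure D →
          iidSeq D {ω | (∃ j < m, ω j ∈ c) ∧
            ENNReal.ofReal ε < err D c ((productLearner A m ε δ).run c ω).out} ≤
              ENNReal.ofReal δ ∧
          iidSeq D {ω | ENNReal.ofReal ε < err D c ((productLearner A m ε δ).run c ω).out} ≤
              ENNReal.ofReal δ + ENNReal.ofReal ((1 - ε) ^ m)) := by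
  have hk := pos_of_empty_mem_boxProd hempty
  refine ⟨fun c p hp i l ω => (splitSample_run c hp i l ω).1,
    fun m c hc ω => productLearner_cost C hk A m ε δ hc ω,
    fun hA m hm => productLearner_pacLearns_of_isERM hempty hA hm, ?_⟩
  rintro m hA c ⟨c, hc, rfl⟩
  refine ⟨fun ω => productLearner_out_mem hempty A m ε δ c ω fun i => ?_, fun D hD => ?_⟩
  · have h := (hA i (c i) (hc i)).1 fun j => ω j i
    rwa [Learner.onSample_run] at h
  have hpos := productLearner_pac_of_positive hC hk hε.1.le hδ.1.le hA hc D
  have hneg := productLearner_pac_of_negative A (δ := δ) hε.1.le m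
    (MeasurableSet.univ_pi fun i => hC i _ (hc i)) D
  refine ⟨hpos, (measure_mono fun ω hω => ?_).trans
    ((measure_union_le _ _).trans (add_le_add hpos hneg))⟩
  by_cases h : ∃ j < m, ω j ∈ Set.univ.pi c
  · exact Or.inl ⟨h, hω⟩
  · push Not at h
    exact Or.inr ⟨h, hω⟩
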